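/- Let $G$ be a finitely generated infinite group. For a finitely generated group $H$ let $d(H)$ be the minimum number of generators of $H$, and let $$RG(G)=\inf_{H\le_f G}\frac{d(H)-1}{[G:H]}$$ be the rank gradient of $G$, the infimum being over all subgroups $H$ of finite index in $G$. Let $\beta_1^{(2)}(G)$ be the first $L^2$-Betti number of $G$, that is, the von Neumann dimension over $G$ of the reduced first $\ell^2$-cohomology $$\overline{H}{}^1(G,\ell^2(G))=Z^1(G,\ell^2(G))\big/\overline{B^1(G,\ell^2(G))}.$$ Here $Z^1$ and $B^1$ are the spaces of 1-cocycles and of 1-coboundaries of $G$ with coefficients in the regular representation on $\ell^2(G)$. For any finite generating set $S$ of $G$ they are regarded as subspaces of the Hilbert $G$-module $\bigoplus_{s\in S}\ell^2(G)$ by restricting cocycles to $S$; the dimension does not depend on $S$. Then $$RG(G)\ \ge\ \beta_1^{(2)}(G).$$ -/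

import Mathlib

open scoped Classical

noncomputable section

namespace L2

/-- The Hilbert space `ℓ²(α)` of square-summable complex functions on `α`. -/
abbrev EllTwo (α : Type*) : Type _ := lp (fun _ : α => ℂ) 2

/-- The von Neumann dimension over a group `G` of (the closure of) a subspace `V` of
`ℓ²(G × ι) = ⨁_{i ∈ ι} ℓ²(G)`, with `ι` finite, which is invariant under the left translations
by `G`.  It is the von Neumann trace `∑ i, ⟪P δ_{(1,i)}, δ_{(1,i)}⟫ = ∑ i, ‖P δ_{(1,i)}‖²` of the
orthogonal projection `P` onto the closure of `V`. -/
def vnDim {G ι : Type*} [Group G] [Fintype ι] (V : Submodule ℂ (EllTwo (G × ι))) : ℝ :=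
  ∑ i : ι, ‖V.topologicalClosure.starProjection (lp.single 2 ((1 : G), i) (1 : ℂ))‖ ^ 2

variable {G : Type*} [Group G]

/-- `b : G → ℓ²(G)` is a 1-cocycle of `G` with coefficients in the regular representation
`(g • f) x = f (x * g)`, i.e. `b (g * h) = b g + g • b h`.  The left translations by `G` commute
with this representation, and so act on the cocycles. -/
def IsCocycle (b : G → EllTwo G) : Prop :=
  ∀ g h x : G, b (g * h) x = b g x + b h (x * g)

/-- The space `Z¹(G, ℓ²(G))` of 1-cocycles, seen inside `⨁_{s ∈ S} ℓ²(G)` through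
`b ↦ (b s)_{s ∈ S}`. When `S` is a finite generating set this map is injective, its image is
closed, and it is a homeomorphism onto its image for the topology of pointwise convergence on
the cocycles. -/
def cocycles (S : Finset G) : Submodule ℂ (EllTwo (G × S)) where
  carrier := {f | ∃ b : G → EllTwo G, IsCocycle b ∧ ∀ (s : S) (x : G), f (x, s) = b s x}
  zero_mem' := ⟨0, fun g h x => by simp, fun s x => by simp⟩
  add_mem' := by
    rintro f f' ⟨b, hb, hf⟩ ⟨b', hb', hf'⟩
    refine ⟨b + b', fun g h x => ?_, fun s x => ?_⟩
    · simp [hb g h x, hb' g h x]; ring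
    · simp [hf s x, hf' s x]
  smul_mem' := by
    rintro c f ⟨b, hb, hf⟩
    refine ⟨c • b, fun g h x => ?_, fun s x => ?_⟩
    · simp [hb g h x]; ring
    · simp [hf s x]

/-- The space `B¹(G, ℓ²(G))` of 1-coboundaries `g ↦ g • u - u` with `u ∈ ℓ²(G)`, seen inside
`⨁_{s ∈ S} ℓ²(G)` in the same way. -/
def coboundaries (S : Finset G) : Submodule ℂ (EllTwo (G × S)) where
  carrier := {f | ∃ u : EllTwo G, ∀ (s : S) (x : G), f (x, s) = u (x * s) - u x}
  zero_mem' := ⟨0, fun s x => by simp⟩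
  add_mem' := by
    rintro f f' ⟨u, hu⟩ ⟨u', hu'⟩
    refine ⟨u + u', fun s x => ?_⟩
    simp [hu s x, hu' s x]; ring
  smul_mem' := by
    rintro c f ⟨u, hu⟩
    refine ⟨c • u, fun s x => ?_⟩
    simp [hu s x]; ring

/-- The first `L²`-Betti number of the group `G`, computed with a finite generating set `S`
of `G`: the von Neumann dimension of the reduced first `ℓ²`-cohomology
`Z¹(G, ℓ²(G)) / closure B¹(G, ℓ²(G))`, which is realised as the orthogonal complement of
`B¹(G, ℓ²(G))` in `Z¹(G, ℓ²(G))`. The value is the same for all finite generating sets `S`. -/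
def firstBetti (S : Finset G) : ℝ :=
  vnDim (cocycles S ⊓ (coboundaries S)ᗮ)

end L2

/-- The rank gradient of a finitely generated group `G`: the infimum of `(d(H) - 1) / [G : H]`
over all subgroups `H` of finite index, where `d(H)` is the minimal number of generators. -/
def rankGradient (G : Type*) [Group G] [Group.FG G] : ℝ :=
  ⨅ H : {H : Subgroup G // H.FiniteIndex},
    haveI : H.1.FiniteIndex := H.2
    ((Group.rank H.1 : ℝ) - 1) / (H.1.index : ℝ)

end

/-! Let `H` have finite index, let `T` be a generating set of `H` with d(H) elements, and let P be
the projection of ℓ²(G × S) onto the space V of harmonic cocycles, whose dimension is β =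
`firstBetti S`. Send (f, u) in ℓ²(G × S) ⊕ ℓ²(H) to the family of b(t)|_H + (t - 1)u, t ∈ T, where b
is the cocycle given by Pf. If this family vanishes, b restricts on `H` to the coboundary of -u.
Finite index then makes b the coboundary of an ℓ² function on `G`
(`IsCocycle.mem_coboundaries_of_restrict`), so b = 0 by orthogonality; now u is constant on the
infinite group `H`, so u = 0. The kernel is thus Vᗮ ⊕ 0, of dimension [G:H](|S| - β) over `H`.

Rank-nullity over `H` (`card_le_card_add`) gives [G:H]|S| + 1 ≤ |T| + [G:H](|S| - β), that is,
[G:H]β ≤ d(H) - 1. It is proved with traces of powers and the mean ergodic theorem, without polar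
decomposition. -/

open scoped Classical

noncomputable section

namespace L2

open Filter Topology ContinuousLinearMap
open Function (Injective Bijective)
open scoped ComplexInnerProductSpace ComplexConjugate

/-! ### Equivariant operators on ℓ² spaces and their traces. -/

section Operators

variable {α β γ : Type*}

/-- Composition with an injective map, as a contraction between `ℓ²` spaces. -/
def pullback (φ : α → β) (hφ : Injective φ) : EllTwo β →L[ℂ] EllTwo α :=
  LinearMap.mkContinuous
    { toFun := fun f => ⟨fun a => f (φ a), memℓp_gen
        (((lp.memℓp f).summable (by norm_num)).comp_injective hφ)⟩
      map_add' := fun _ _ => rfl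
      map_smul' := fun _ _ => rfl } 1 fun f => by
    rw [one_mul]
    refine lp.norm_le_of_tsum_le (by norm_num) (norm_nonneg _) ?_
    rw [lp.norm_rpow_eq_tsum (by norm_num) f]
    exact (((lp.memℓp f).summable (by norm_num)).comp_injective hφ).tsum_le_tsum_of_inj φ hφ
      (fun _ _ => by positivity) (fun _ => le_rfl) ((lp.memℓp f).summable (by norm_num))

@[simp]
theorem pullback_apply (φ : α → β) (hφ : Injective φ) (f : EllTwo β) (a : α) :
    pullback φ hφ f a = f (φ a) := rfl

/-- The basis vectors of `ℓ²(α)`. -/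
def delta (a : α) : EllTwo α := lp.single 2 a (1 : ℂ)

theorem delta_apply (a b : α) : delta a b = if b = a then 1 else 0 := by
  simp [delta, Pi.single_apply]

@[simp]
theorem norm_delta (a : α) : ‖delta a‖ = 1 := by
  simp [delta, lp.norm_single]

@[simp]
theorem inner_delta_left (a : α) (f : EllTwo α) : ⟪delta a, f⟫ = f a := by
  simp [delta, lp.inner_single_left]

@[simp]
theorem inner_delta_right (a : α) (f : EllTwo α) : ⟪f, delta a⟫ = conj (f a) := by
  rw [← inner_conj_symm, inner_delta_left]

theorem adjoint_delta_apply (X : EllTwo α →L[ℂ] EllTwo β) (a : α) (b : β) :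
    adjoint X (delta b) a = conj (X (delta a) b) := by
  rw [← inner_delta_left, adjoint_inner_right, inner_delta_right]

theorem hasSum_apply (Y : EllTwo α →L[ℂ] EllTwo β) (f : EllTwo α) (b : β) :
    HasSum (fun a => f a * Y (delta a) b) (Y f b) := by
  have h := lp.hasSum_inner (𝕜 := ℂ) (adjoint Y (delta b)) f
  rw [adjoint_inner_left, inner_delta_left] at h
  simpa [adjoint_delta_apply] using h

/-- The unitary operator on `ℓ²(α)` given by a permutation. -/
abbrev permute (e : Equiv.Perm α) : EllTwo α →L[ℂ] EllTwo α := pullback e e.injective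

theorem permute_delta (e : Equiv.Perm α) (a : α) : permute e (delta (e a)) = delta a := by
  ext b
  simp [delta_apply]

theorem permute_inv_permute (e : Equiv.Perm α) (f : EllTwo α) : permute e⁻¹ (permute e f) = f := by
  ext a; simp

theorem permute_permute_inv (e : Equiv.Perm α) (f : EllTwo α) : permute e (permute e⁻¹ f) = f := by
  ext a; simp

theorem adjoint_permute (e : Equiv.Perm α) : adjoint (permute e) = permute e⁻¹ := by
  symm
  rw [eq_adjoint_iff]
  intro f g
  rw [lp.inner_eq_tsum, lp.inner_eq_tsum, ← e.tsum_eq]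
  simp

variable {Γ ι κ : Type*}

/-- An operator intertwining two actions by permutations. -/
def Equivariant (σ : Γ → Equiv.Perm α) (τ : Γ → Equiv.Perm β)
    (X : EllTwo α →L[ℂ] EllTwo β) : Prop :=
  ∀ g f, X (permute (σ g) f) = permute (τ g) (X f)

namespace Equivariant

variable {σ : Γ → Equiv.Perm α} {τ : Γ → Equiv.Perm β} {ρ : Γ → Equiv.Perm γ}

theorem comp {X : EllTwo β →L[ℂ] EllTwo γ} {Y : EllTwo α →L[ℂ] EllTwo β}
    (hX : Equivariant τ ρ X) (hY : Equivariant σ τ Y) : Equivariant σ ρ (X ∘L Y) := by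
  intro g f
  simp only [comp_apply, hY g, hX g]

theorem add {X Y : EllTwo α →L[ℂ] EllTwo β}
    (hX : Equivariant σ τ X) (hY : Equivariant σ τ Y) : Equivariant σ τ (X + Y) := by
  intro g f
  simp only [add_apply, hX g, hY g, map_add]

theorem neg {X : EllTwo α →L[ℂ] EllTwo β} (hX : Equivariant σ τ X) : Equivariant σ τ (-X) := by
  intro g f
  simp only [neg_apply, hX g, map_neg]

theorem smul {X : EllTwo α →L[ℂ] EllTwo β} (hX : Equivariant σ τ X) (c : ℂ) :
    Equivariant σ τ (c • X) := by
  intro g f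
  simp only [smul_apply, hX g, map_smul]

theorem sub {X Y : EllTwo α →L[ℂ] EllTwo β}
    (hX : Equivariant σ τ X) (hY : Equivariant σ τ Y) : Equivariant σ τ (X - Y) := by
  intro g f
  simp only [sub_apply, hX g, hY g, map_sub]

theorem one : Equivariant σ σ (1 : EllTwo α →L[ℂ] EllTwo α) := fun _ _ => rfl

theorem pow {X : EllTwo α →L[ℂ] EllTwo α} (hX : Equivariant σ σ X) (n : ℕ) :
    Equivariant σ σ (X ^ n) := by
  induction n with
  | zero => exact one
  | succ n ih => exact ih.comp hX

theorem adjoint {X : EllTwo α →L[ℂ] EllTwo β} (hX : Equivariant σ τ X) :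
    Equivariant τ σ (adjoint X) := by
  intro g f
  refine ext_inner_left ℂ fun v => ?_
  have h := hX g (permute (σ g)⁻¹ v)
  rw [permute_permute_inv] at h
  rw [adjoint_inner_right, h, ← adjoint_inner_left, adjoint_permute, permute_inv_permute,
    ← adjoint_inner_right, ← adjoint_permute, adjoint_inner_left]

theorem apply_delta {X : EllTwo α →L[ℂ] EllTwo β} (hX : Equivariant σ τ X) (g : Γ) (a : α)
    (b : β) : X (delta a) (τ g b) = X (delta ((σ g)⁻¹ a)) b := by
  have h := hX g (delta a)
  have h' : permute (σ g) (delta a) = delta ((σ g)⁻¹ a) := by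
    simpa using permute_delta (σ g) ((σ g)⁻¹ a)
  rw [← h', h, pullback_apply]

end Equivariant

/-- The trace of an operator over a family of base points. -/
def trace [Fintype ι] (a : ι → α) (X : EllTwo α →L[ℂ] EllTwo α) : ℂ :=
  ∑ i, X (delta (a i)) (a i)

section Trace

variable [Fintype ι] [Fintype κ]

theorem trace_sub (a : ι → α) (X Y : EllTwo α →L[ℂ] EllTwo α) :
    trace a (X - Y) = trace a X - trace a Y := by
  simp [trace]

theorem trace_one (a : ι → α) : trace a 1 = Fintype.card ι := by
  simp [trace, delta_apply]

theorem _root_.HasSum.eq_sum_tsum_of_fintype {F : Γ × κ → ℂ} {s : ℂ} (h : HasSum F s) :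
    s = ∑ t, ∑' g, F (g, t) := by
  have h' : Summable fun p : κ × Γ => F p.swap := h.summable.prod_symm
  rw [← h.tsum_eq, ← (Equiv.prodComm κ Γ).tsum_eq F, ← tsum_fintype (L := .unconditional κ)]
  exact h'.tsum_prod

variable {σ : Γ → Equiv.Perm α} {τ : Γ → Equiv.Perm β} {a : ι → α} {c : κ → β}

/-- `ha` and `hc` say that the base points represent the orbits of free actions. Expand one side
over the points τ_g c_t and the other over the points σ_g⁻¹ a_i: equivariance moves g from one index
of a matrix coefficient to the other, so the two double sums agree term by term. -/
theorem trace_comp_comm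
    (ha : Bijective fun p : Γ × ι => (σ p.1)⁻¹ (a p.2))
    (hc : Bijective fun p : Γ × κ => τ p.1 (c p.2))
    {X : EllTwo α →L[ℂ] EllTwo β} {Y : EllTwo β →L[ℂ] EllTwo α}
    (hX : Equivariant σ τ X) (hY : Equivariant τ σ Y) :
    trace a (Y ∘L X) = trace c (X ∘L Y) := by
  have h1 (i : ι) := ((Equiv.ofBijective _ hc).hasSum_iff.mpr
    (hasSum_apply Y (X (delta (a i))) (a i))).eq_sum_tsum_of_fintype
  have h2 (t : κ) := ((Equiv.ofBijective _ ha).hasSum_iff.mpr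
    (hasSum_apply X (Y (delta (c t))) (c t))).eq_sum_tsum_of_fintype
  simp only [trace, comp_apply, h1, h2]
  rw [Finset.sum_comm]
  refine Finset.sum_congr rfl fun t _ => Finset.sum_congr rfl fun i _ => tsum_congr fun g => ?_
  have h3 := hY.apply_delta g (τ g (c t)) ((σ g)⁻¹ (a i))
  have e1 : (τ g)⁻¹ (τ g (c t)) = c t := (τ g).symm_apply_apply _
  have e2 : σ g ((σ g)⁻¹ (a i)) = a i := (σ g).apply_symm_apply _
  rw [e1, e2] at h3
  change X (delta (a i)) (τ g (c t)) * Y (delta (τ g (c t))) (a i) =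
    Y (delta (c t)) ((σ g)⁻¹ (a i)) * X (delta ((σ g)⁻¹ (a i))) (c t)
  rw [hX.apply_delta, h3, mul_comm]

theorem comp_pow_one_sub_adjoint_comp (A : EllTwo α →L[ℂ] EllTwo β) (n : ℕ) (v : EllTwo α) :
    A (((1 - adjoint A ∘L A) ^ n) v) = ((1 - A ∘L adjoint A) ^ n) (A v) := by
  induction n generalizing v with
  | zero => rfl
  | succ n ih =>
    rw [pow_succ, pow_succ]
    change A (((1 - adjoint A ∘L A) ^ n) (v - adjoint A (A v))) =
      ((1 - A ∘L adjoint A) ^ n) (A v - A (adjoint A (A v)))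
    rw [ih, map_sub]

/-- Raising the exponent by one subtracts tr((1 - A*A)ⁿA*A) on the left and tr(A(1 - A*A)ⁿA*) on the
right; these are equal by `trace_comp_comm`. -/
theorem card_sub_trace_pow
    (ha : Bijective fun p : Γ × ι => (σ p.1)⁻¹ (a p.2))
    (hc : Bijective fun p : Γ × κ => τ p.1 (c p.2))
    {A : EllTwo α →L[ℂ] EllTwo β} (hA : Equivariant σ τ A) (n : ℕ) :
    (Fintype.card ι : ℂ) - trace a ((1 - adjoint A ∘L A) ^ n) =
      Fintype.card κ - trace c ((1 - A ∘L adjoint A) ^ n) := by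
  induction n with
  | zero => simp [trace_one]
  | succ n ih =>
    have hf := ((Equivariant.one (σ := σ)).sub (hA.adjoint.comp hA)).pow n
    have key := trace_comp_comm ha hc hA (hf.comp hA.adjoint)
    have h1 : (1 - adjoint A ∘L A) ^ (n + 1) =
        (1 - adjoint A ∘L A) ^ n - (((1 - adjoint A ∘L A) ^ n) ∘L adjoint A) ∘L A := by
      rw [pow_succ, mul_sub, mul_one]; rfl
    have h2 : (1 - A ∘L adjoint A) ^ (n + 1) =
        (1 - A ∘L adjoint A) ^ n - A ∘L (((1 - adjoint A ∘L A) ^ n) ∘L adjoint A) := by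
      rw [pow_succ, mul_sub, mul_one]
      congr 1
      ext1 v
      exact (comp_pow_one_sub_adjoint_comp A n (adjoint A v)).symm
    rw [h1, h2, trace_sub, trace_sub, key]
    linear_combination ih

end Trace

end Operators

/-! ### Rank-nullity inequality for the von Neumann dimension. -/

section Dimension

variable {α β Γ ι κ : Type*}

theorem norm_adjoint_apply_le {A : EllTwo α →L[ℂ] EllTwo β} (hA : ‖A‖ ≤ 1) (x : EllTwo β) :
    ‖adjoint A x‖ ≤ ‖x‖ := by
  refine (le_opNorm _ x).trans ?_
  rw [LinearIsometryEquiv.norm_map]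
  exact mul_le_of_le_one_left (norm_nonneg _) hA

theorem isPositive_one_sub_comp_adjoint {A : EllTwo α →L[ℂ] EllTwo β} (hA : ‖A‖ ≤ 1) :
    (1 - A ∘L adjoint A).IsPositive := by
  refine isPositive_def.mpr ⟨?_, fun x => ?_⟩
  · intro x y
    change ⟪x - A (adjoint A x), y⟫ = ⟪x, y - A (adjoint A y)⟫
    rw [inner_sub_left, inner_sub_right, ← adjoint_inner_right, ← adjoint_inner_left A]
  · change 0 ≤ RCLike.re ⟪x - A (adjoint A x), x⟫
    rw [inner_sub_left, ← adjoint_inner_right, inner_self_eq_norm_sq_to_K,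
      inner_self_eq_norm_sq_to_K, map_sub]
    have h := norm_adjoint_apply_le hA x
    have h' : ‖adjoint A x‖ ^ 2 ≤ ‖x‖ ^ 2 := by gcongr
    norm_cast
    simpa using h'

theorem _root_.ContinuousLinearMap.IsPositive.pow_of_complex {E : Type*} [NormedAddCommGroup E]
    [InnerProductSpace ℂ E] [CompleteSpace E] {T : E →L[ℂ] E} (hT : T.IsPositive) (n : ℕ) :
    (T ^ n).IsPositive := by
  induction n using Nat.twoStepInduction with
  | zero => exact isPositive_one
  | one => simpa using hT
  | more n ih _ =>
    have h := ih.conj_adjoint T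
    rw [hT.isSelfAdjoint.adjoint_eq] at h
    convert h using 1
    rw [pow_succ', pow_succ]
    rfl

theorem norm_one_sub_adjoint_comp_le {A : EllTwo α →L[ℂ] EllTwo β} (hA : ‖A‖ ≤ 1) :
    ‖1 - adjoint A ∘L A‖ ≤ 1 := by
  refine opNorm_le_bound _ zero_le_one fun x => ?_
  rw [one_mul]
  change ‖x - adjoint A (A x)‖ ≤ ‖x‖
  have h1 : ‖adjoint A (A x)‖ ^ 2 ≤ ‖A x‖ ^ 2 := by
    gcongr; exact norm_adjoint_apply_le hA _
  have h2 := norm_sub_sq (𝕜 := ℂ) x (adjoint A (A x))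
  rw [adjoint_inner_right, inner_self_eq_norm_sq_to_K] at h2
  norm_cast at h2
  exact le_of_sq_le_sq (by nlinarith [sq_nonneg ‖A x‖]) (norm_nonneg _)

theorem eqLocus_one_sub_adjoint_comp (A : EllTwo α →L[ℂ] EllTwo β) :
    (1 - adjoint A ∘L A).eqLocus (1 : EllTwo α →L[ℂ] EllTwo α) = A.ker := by
  ext x
  change x - adjoint A (A x) = x ↔ A x = 0
  rw [sub_eq_self]
  refine ⟨fun h => ?_, fun h => by rw [h, map_zero]⟩
  rw [← inner_self_eq_zero (𝕜 := ℂ), ← adjoint_inner_right, h, inner_zero_right]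

variable [Fintype ι] [Fintype κ] {σ : Γ → Equiv.Perm α} {τ : Γ → Equiv.Perm β}
  {a : ι → α} {c : κ → β}

/-- Put f = 1 - A*A, a contraction whose fixed space is ker A. Since 1 - AA* is positive,
`card_sub_trace_pow` bounds the trace of every fⁿ below by |ι| - |κ|. By the mean ergodic theorem
the averages of the fⁿ converge strongly to the projection onto ker A, so its trace satisfies the
same bound. -/
theorem card_le_card_add_of_norm_le_one
    (ha : Bijective fun p : Γ × ι => (σ p.1)⁻¹ (a p.2))
    (hc : Bijective fun p : Γ × κ => τ p.1 (c p.2))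
    {A : EllTwo α →L[ℂ] EllTwo β} (hA : Equivariant σ τ A) (hn : ‖A‖ ≤ 1) :
    (Fintype.card ι : ℝ) ≤
      Fintype.card κ + ∑ i, ‖A.ker.starProjection (delta (a i))‖ ^ 2 := by
  obtain ⟨f, hf⟩ : ∃ f : EllTwo α →L[ℂ] EllTwo α, f = 1 - adjoint A ∘L A := ⟨_, rfl⟩
  have hlim (i : ι) : Tendsto (fun N => birkhoffAverage ℂ f _root_.id N (delta (a i))) atTop
      (𝓝 (A.ker.starProjection (delta (a i)))) := by
    have h := tendsto_birkhoffAverage_orthogonalProjection f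
      (hf ▸ norm_one_sub_adjoint_comp_le hn) (delta (a i))
    simpa only [← Submodule.starProjection_apply, hf, eqLocus_one_sub_adjoint_comp] using h
  have hlim' : Tendsto (fun N => ∑ i, RCLike.re ⟪birkhoffAverage ℂ f _root_.id N (delta (a i)),
      delta (a i)⟫) atTop (𝓝 (∑ i, ‖A.ker.starProjection (delta (a i))‖ ^ 2)) := by
    refine tendsto_finsetSum _ fun i _ => ?_
    have h2 := A.ker.re_inner_starProjection_eq_normSq (delta (a i))
    have h3 : ‖A.ker.starProjection (delta (a i))‖ =
        ‖A.ker.orthogonalProjectionOnto (delta (a i))‖ := rfl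
    rw [h3, ← h2]
    exact (RCLike.continuous_re.tendsto _).comp ((hlim i).inner tendsto_const_nhds)
  suffices (Fintype.card ι : ℝ) - Fintype.card κ ≤
      ∑ i, ‖A.ker.starProjection (delta (a i))‖ ^ 2 by linarith
  refine ge_of_tendsto hlim' ((eventually_gt_atTop 0).mono fun N hN => ?_)
  have htr (n : ℕ) : (Fintype.card ι : ℝ) - Fintype.card κ ≤
      (trace a (f ^ n)).re := by
    have h := congrArg Complex.re (card_sub_trace_pow ha hc hA n)
    rw [← hf] at h
    have h0 : 0 ≤ (trace c ((1 - A ∘L adjoint A) ^ n)).re := by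
      rw [trace, Complex.re_sum]
      refine Finset.sum_nonneg fun t _ => ?_
      have := ((isPositive_one_sub_comp_adjoint hn).pow_of_complex n).re_inner_nonneg_right
        (delta (c t))
      simpa using this
    simp at h
    linarith
  have hsum : ∑ i, RCLike.re ⟪birkhoffAverage ℂ f _root_.id N (delta (a i)), delta (a i)⟫ =
      (N : ℝ)⁻¹ * ∑ n ∈ Finset.range N, (trace a (f ^ n)).re := by
    simp only [birkhoffAverage, birkhoffSum, trace, Complex.re_sum, _root_.id]
    rw [Finset.sum_comm, Finset.mul_sum]
    refine Finset.sum_congr rfl fun i _ => ?_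
    have hpow (n : ℕ) : f^[n] (delta (a i)) = (f ^ n) (delta (a i)) := by
      rw [FunLike.coe_pow_eq_iterate]
    simp only [hpow]
    rw [← Complex.ofReal_natCast, ← Complex.ofReal_inv, inner_smul_left, sum_inner]
    simp
  rw [hsum, ← div_eq_inv_mul, le_div_iff₀ (by exact_mod_cast hN), mul_comm]
  simpa using Finset.card_nsmul_le_sum (Finset.range N) _ _ fun n _ => htr n

/-- For an equivariant operator, the dimension of the domain is at most the dimension of the
codomain plus the dimension of the kernel. -/
theorem card_le_card_add
    (ha : Bijective fun p : Γ × ι => (σ p.1)⁻¹ (a p.2))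
    (hc : Bijective fun p : Γ × κ => τ p.1 (c p.2))
    {A : EllTwo α →L[ℂ] EllTwo β} (hA : Equivariant σ τ A) :
    (Fintype.card ι : ℝ) ≤
      Fintype.card κ + ∑ i, ‖A.ker.starProjection (delta (a i))‖ ^ 2 := by
  -- Rescaling `A` to a contraction keeps its kernel; the `+ 1` covers `A = 0`.
  obtain ⟨r, hr⟩ : ∃ r : ℂ, r = ((‖A‖ + 1)⁻¹ : ℝ) := ⟨_, rfl⟩
  have hr0 : r ≠ 0 := by
    rw [hr]; norm_cast; positivity
  have hn : ‖r • A‖ ≤ 1 := by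
    rw [norm_smul, hr, Complex.norm_real, norm_inv, Real.norm_of_nonneg (by positivity),
      inv_mul_le_one₀ (by positivity)]
    linarith
  have hker : (r • A).ker = A.ker := by
    ext x
    simp [hr0]
  have h := card_le_card_add_of_norm_le_one ha hc (hA.smul r) hn
  simpa only [hker] using h

end Dimension

/-! ### Projections onto invariant subspaces, and coordinates of ℓ²(α × ι). -/

section Projections

variable {α β Γ ι : Type*}

theorem permute_mem_orthogonal {V : Submodule ℂ (EllTwo α)} {e : Equiv.Perm α}
    (h : ∀ f ∈ V, permute e⁻¹ f ∈ V) {f : EllTwo α} (hf : f ∈ Vᗮ) : permute e f ∈ Vᗮ := by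
  rw [Submodule.mem_orthogonal] at hf ⊢
  intro w hw
  rw [← adjoint_inner_left, adjoint_permute]
  exact hf _ (h w hw)

theorem starProjection_permute {V : Submodule ℂ (EllTwo α)} [V.HasOrthogonalProjection]
    {e : Equiv.Perm α} (h : ∀ f ∈ V, permute e f ∈ V) (h' : ∀ f ∈ V, permute e⁻¹ f ∈ V)
    (f : EllTwo α) : V.starProjection (permute e f) = permute e (V.starProjection f) := by
  refine Submodule.eq_starProjection_of_mem_orthogonal
    (h _ (Submodule.starProjection_apply_mem _ _)) ?_
  rw [← map_sub]
  exact permute_mem_orthogonal h' (Submodule.sub_starProjection_mem_orthogonal _)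

theorem norm_permute (e : Equiv.Perm α) (f : EllTwo α) : ‖permute e f‖ = ‖f‖ := by
  have h : ⟪permute e f, permute e f⟫ = ⟪f, f⟫ := by
    rw [← adjoint_inner_left, adjoint_permute, permute_inv_permute]
  rw [inner_self_eq_norm_sq_to_K, inner_self_eq_norm_sq_to_K] at h
  norm_cast at h
  exact (sq_eq_sq₀ (norm_nonneg _) (norm_nonneg _)).mp h

/-- The coordinate `ℓ²(α × ι) → ℓ²(α)` of index `i`. -/
def slice (i : ι) : EllTwo (α × ι) →L[ℂ] EllTwo α :=
  pullback (fun a => (a, i)) (Prod.mk_left_injective i)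

@[simp]
theorem slice_apply (i : ι) (f : EllTwo (α × ι)) (a : α) : slice i f a = f (a, i) := rfl

theorem adjoint_slice_apply (i j : ι) (f : EllTwo α) (a : α) :
    adjoint (slice i) f (a, j) = if j = i then f a else 0 := by
  rw [← inner_delta_left, adjoint_inner_right]
  split_ifs with h
  · subst h
    rw [← inner_delta_left]
    congr 1
    ext b
    simp [delta_apply]
  · rw [← inner_zero_left f]
    congr 1
    ext b
    simp [delta_apply, Ne.symm h]

/-- The operator into `ℓ²(α × ι)` with given coordinates. -/
def glue [Fintype ι] (M : ι → EllTwo β →L[ℂ] EllTwo α) : EllTwo β →L[ℂ] EllTwo (α × ι) :=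
  ∑ i, adjoint (slice i) ∘L M i

theorem glue_apply [Fintype ι] (M : ι → EllTwo β →L[ℂ] EllTwo α) (f : EllTwo β) (a : α) (i : ι) :
    glue M f (a, i) = M i f a := by
  rw [glue, sum_apply, lp.coeFn_sum, Finset.sum_apply]
  simp [adjoint_slice_apply]

/-- A permutation of the first factor. -/
abbrev prodPerm (ι : Type*) (e : Equiv.Perm α) : Equiv.Perm (α × ι) :=
  Equiv.prodCongr e (Equiv.refl ι)

theorem Equivariant.glue [Fintype ι] {σ : Γ → Equiv.Perm β} {τ : Γ → Equiv.Perm α}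
    {M : ι → EllTwo β →L[ℂ] EllTwo α} (hM : ∀ i, Equivariant σ τ (M i)) :
    Equivariant σ (fun g => prodPerm ι (τ g)) (glue M) := by
  intro g f
  ext ⟨a, i⟩
  rw [glue_apply, hM i g]
  change M i f (τ g a) = L2.glue M f (τ g a, i)
  rw [glue_apply]

theorem eq_zero_of_forall_eq [Infinite α] {f : EllTwo α} {c : ℂ} (h : ∀ a, f a = c) : f = 0 := by
  have hs := (lp.memℓp f).summable (by norm_num)
  simp only [h, summable_const_iff] at hs
  ext a
  rw [h]
  simpa using hs

end Projections

/-! ### Cocycles, coboundaries and harmonic cocycles. -/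

section Cocycles

variable {G : Type*} [Group G] {S : Finset G}

theorem IsCocycle.apply_one {b : G → EllTwo G} (hb : IsCocycle b) : b 1 = 0 := by
  ext x
  have := hb 1 1 x
  simpa using this

theorem IsCocycle.apply_eq {b : G → EllTwo G} (hb : IsCocycle b) (g x : G) :
    b g x = b (x * g) 1 - b x 1 := by
  rw [hb x g 1, one_mul]; ring

/-- The values of a cocycle depend boundedly on its values on a generating set. -/
theorem exists_cocycle_evaluation (hS : Subgroup.closure (S : Set G) = ⊤) (g : G) :
    ∃ D : EllTwo (G × S) →L[ℂ] EllTwo G,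
      Equivariant (fun k => prodPerm S (Equiv.mulLeft k)) Equiv.mulLeft D ∧
      ∀ (b : G → EllTwo G) (f : EllTwo (G × S)), IsCocycle b →
        (∀ (s : S) (x : G), f (x, s) = b s x) → D f = b g := by
  have hg : g ∈ Subgroup.closure (S : Set G) := hS ▸ Subgroup.mem_top g
  have hR (k : G) : Equivariant Equiv.mulLeft Equiv.mulLeft (permute (Equiv.mulRight k)) := by
    intro l f
    ext x
    simp [mul_assoc]
  induction hg using Subgroup.closure_induction with
  | mem s hs =>
    refine ⟨slice ⟨s, hs⟩, fun k f => rfl, fun b f _ hf => ?_⟩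
    ext x
    exact hf ⟨s, hs⟩ x
  | one => exact ⟨0, fun k f => by simp, fun b f hb _ => by simp [hb.apply_one]⟩
  | mul g h _ _ ihg ihh =>
    obtain ⟨D, hD, hD'⟩ := ihg
    obtain ⟨E, hE, hE'⟩ := ihh
    refine ⟨D + permute (Equiv.mulRight g) ∘L E, hD.add ((hR g).comp hE), fun b f hb hf => ?_⟩
    ext x
    rw [hb, ← hD' b f hb hf, ← hE' b f hb hf]
    rfl
  | inv g _ ih =>
    obtain ⟨D, hD, hD'⟩ := ih
    refine ⟨-(permute (Equiv.mulRight g⁻¹) ∘L D), ((hR _).comp hD).neg, fun b f hb hf => ?_⟩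
    ext x
    have h := hb g⁻¹ g x
    rw [inv_mul_cancel, hb.apply_one] at h
    change -(D f (x * g⁻¹)) = b g⁻¹ x
    rw [hD' b f hb hf]
    change 0 = _ at h
    linear_combination h

/-- A point f lies in the set exactly when g ↦ D g f is a cocycle that extends it; these are
equalities between continuous functionals of f. -/
theorem isClosed_cocycles (hS : Subgroup.closure (S : Set G) = ⊤) :
    IsClosed (cocycles S : Set (EllTwo (G × S))) := by
  choose D _ hD using exists_cocycle_evaluation hS
  have hc (g x : G) : Continuous fun f => D g f x :=
    ((lp.evalCLM ℂ (fun _ : G => ℂ) 2 x) ∘L D g).continuous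
  have hc' (p : G × S) : Continuous fun f : EllTwo (G × S) => f p :=
    (lp.evalCLM ℂ (fun _ : G × S => ℂ) 2 p).continuous
  have h : (cocycles S : Set (EllTwo (G × S))) =
      {f | ∀ g h x : G, D (g * h) f x = D g f x + D h f (x * g)} ∩
        {f | ∀ (s : S) (x : G), f (x, s) = D s f x} := by
    ext f
    refine ⟨fun ⟨b, hb, hf⟩ => ?_, fun ⟨h1, h2⟩ => ⟨fun g => D g f, h1, h2⟩⟩
    refine ⟨fun g h x => ?_, fun s x => ?_⟩
    · rw [hD _ b f hb hf, hD _ b f hb hf, hD _ b f hb hf, hb]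
    · rw [hD _ b f hb hf, hf]
  rw [h]
  simp only [Set.ofPred_forall]
  refine IsClosed.inter ?_ ?_
  · exact isClosed_iInter fun g => isClosed_iInter fun h => isClosed_iInter fun x =>
      isClosed_eq (hc _ _) ((hc _ _).add (hc _ _))
  · exact isClosed_iInter fun s => isClosed_iInter fun x => isClosed_eq (hc' _) (hc _ _)

theorem permute_mem_cocycles (g : G) {f : EllTwo (G × S)} (hf : f ∈ cocycles S) :
    permute (prodPerm S (Equiv.mulLeft g)) f ∈ cocycles S := by
  obtain ⟨b, hb, hf⟩ := hf
  refine ⟨fun k => permute (Equiv.mulLeft g) (b k), fun k l x => ?_, fun s x => hf s (g * x)⟩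
  change b (k * l) (g * x) = b k (g * x) + b l (g * (x * k))
  rw [hb, mul_assoc]

theorem permute_mem_coboundaries (g : G) {f : EllTwo (G × S)} (hf : f ∈ coboundaries S) :
    permute (prodPerm S (Equiv.mulLeft g)) f ∈ coboundaries S := by
  obtain ⟨u, hf⟩ := hf
  refine ⟨permute (Equiv.mulLeft g) u, fun s x => ?_⟩
  change f (g * x, s) = u (g * (x * s)) - u (g * x)
  rw [hf, mul_assoc]

theorem prodPerm_mulLeft_inv (g : G) :
    (prodPerm S (Equiv.mulLeft g))⁻¹ = prodPerm S (Equiv.mulLeft g⁻¹) := by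
  ext ⟨x, s⟩ <;> rfl

/-- The harmonic cocycles, which represent the reduced first `ℓ²`-cohomology. -/
abbrev harmonicCocycles (S : Finset G) : Submodule ℂ (EllTwo (G × S)) :=
  cocycles S ⊓ (coboundaries S)ᗮ

theorem permute_mem_harmonicCocycles (g : G) {f : EllTwo (G × S)} (hf : f ∈ harmonicCocycles S) :
    permute (prodPerm S (Equiv.mulLeft g)) f ∈ harmonicCocycles S := by
  refine ⟨permute_mem_cocycles g hf.1, permute_mem_orthogonal (fun w hw => ?_) hf.2⟩
  rw [prodPerm_mulLeft_inv]
  exact permute_mem_coboundaries _ hw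

theorem topologicalClosure_harmonicCocycles (hS : Subgroup.closure (S : Set G) = ⊤) :
    (harmonicCocycles S).topologicalClosure = harmonicCocycles S :=
  IsClosed.submodule_topologicalClosure_eq
    ((isClosed_cocycles hS).inter (Submodule.isClosed_orthogonal _))

theorem starProjection_harmonicCocycles_permute
    [(harmonicCocycles S).HasOrthogonalProjection] (g : G) (f : EllTwo (G × S)) :
    (harmonicCocycles S).starProjection (permute (prodPerm S (Equiv.mulLeft g)) f) =
      permute (prodPerm S (Equiv.mulLeft g)) ((harmonicCocycles S).starProjection f) := by
  refine starProjection_permute (fun f hf => permute_mem_harmonicCocycles g hf)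
    (fun f hf => ?_) f
  rw [prodPerm_mulLeft_inv]
  exact permute_mem_harmonicCocycles _ hf

/-- Left invariance allows any g as base point. Over a subgroup `H` the base points run through a
transversal, and each of its elements contributes one copy of `firstBetti S`: this is how the index
enters. -/
theorem firstBetti_eq_sum [(harmonicCocycles S).HasOrthogonalProjection]
    (hS : Subgroup.closure (S : Set G) = ⊤) (g : G) :
    firstBetti S = ∑ s : S, ‖(harmonicCocycles S).starProjection (delta (g, s))‖ ^ 2 := by
  rw [firstBetti, vnDim]
  refine Finset.sum_congr rfl fun s _ => ?_
  have h : permute (prodPerm S (Equiv.mulLeft g)) (delta (g, s)) = delta ((1 : G), s) := by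
    rw [← permute_delta (prodPerm S (Equiv.mulLeft g)) (1, s)]
    simp
  rw [← norm_permute (prodPerm S (Equiv.mulLeft g)) ((harmonicCocycles S).starProjection _),
    ← starProjection_harmonicCocycles_permute, h]
  simp only [topologicalClosure_harmonicCocycles hS, delta]
  congr!

end Cocycles

/-! ### Restriction to a subgroup of finite index. -/

section Subgroups

variable {G : Type*} [Group G] {S : Finset G}

theorem _root_.Subgroup.apply_eq_of_forall_mul_eq {T : Set G} (hT : Subgroup.closure T = ⊤)
    {X : Type*} {w : G → X} (hw : ∀ t ∈ T, ∀ g, w (g * t) = w g) (g h : G) : w g = w h := by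
  suffices ∀ k g, w (g * k) = w g by simpa using (this (g⁻¹ * h) g).symm
  intro k
  have hk : k ∈ Subgroup.closure T := hT ▸ Subgroup.mem_top k
  induction hk using Subgroup.closure_induction with
  | mem t ht => exact hw t ht
  | one => simp
  | mul k l _ _ ihk ihl => intro g; rw [← mul_assoc, ihl, ihk]
  | inv k _ ih => intro g; rw [← ih, inv_mul_cancel_right]

variable {H : Subgroup G}

/-- A cocycle of `G` whose restriction to a subgroup of finite index is the coboundary of an
`ℓ²` function is itself such a coboundary. -/
theorem IsCocycle.mem_coboundaries_of_restrict [H.FiniteIndex] {b : G → EllTwo G}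
    (hb : IsCocycle b) {f : EllTwo (G × S)} (hf : ∀ (s : S) (x : G), f (x, s) = b s x)
    {T : Finset H} (hT : Subgroup.closure (T : Set H) = ⊤) {u : EllTwo H}
    (hu : ∀ t ∈ T, ∀ h : H, b t h = u (h * t) - u h) : f ∈ coboundaries S := by
  obtain ⟨R, hR, -⟩ := H.exists_isComplement_right 1
  have : Fintype R := hR.finite_right.fintype
  -- By `apply_eq`, b is the coboundary of β(x) = b x 1, which need not be in ℓ². On `H`, β and u
  -- have the same coboundary, so they differ by a constant.
  have hconst (h : H) : b (h : G) 1 - u h = b ((1 : H) : G) 1 - u 1 := by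
    refine Subgroup.apply_eq_of_forall_mul_eq hT (w := fun h : H => b (h : G) 1 - u h) ?_ h 1
    intro t ht h
    have h1 := hu t ht h
    rw [hb.apply_eq] at h1
    change b ((h : G) * t) 1 - u (h * t) = b h 1 - u h
    linear_combination h1
  let e : H × R ≃ G := Equiv.ofBijective _ hR
  -- The cocycle identity gives β(hr) = β(h) + b r h. Up to the constant this is u(h) + b r h,
  -- square-summable in h for each of the finitely many r.
  let v : EllTwo (H × R) := ∑ r : R, adjoint (slice r)
    (pullback Subtype.val Subtype.val_injective (b r) + u)
  have hv (h : H) (r : R) : v (h, r) = b r h + u h := by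
    simp only [v]
    rw [lp.coeFn_sum, Finset.sum_apply, Finset.sum_eq_single r
      (fun x _ hx => by rw [adjoint_slice_apply, if_neg hx.symm]) (by simp),
      adjoint_slice_apply, if_pos rfl]
    rfl
  have hw (x : G) : v (e.symm x) = b x 1 - (b ((1 : H) : G) 1 - u 1) := by
    obtain ⟨⟨h, r⟩, rfl⟩ := e.surjective x
    rw [e.symm_apply_apply, hv, hb.apply_eq, ← hconst h]
    change _ = b ((h : G) * r) 1 - _
    ring
  refine ⟨pullback e.symm e.symm.injective v, fun s x => ?_⟩
  rw [hf, hb.apply_eq, pullback_apply, pullback_apply, hw, hw]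
  ring

theorem norm_sq_starProjection_delta {α : Type*} (K : Submodule ℂ (EllTwo α))
    [K.HasOrthogonalProjection] (q : α) :
    ((‖K.starProjection (delta q)‖ ^ 2 : ℝ) : ℂ) = K.starProjection (delta q) q := by
  rw [← inner_delta_left q (K.starProjection (delta q)),
    ← Submodule.starProjection_eq_self_iff.mpr (K.starProjection_apply_mem (delta q)),
    ← K.inner_starProjection_left_eq_right,
    Submodule.starProjection_eq_self_iff.mpr (K.starProjection_apply_mem (delta q)),
    inner_self_eq_norm_sq_to_K]
  norm_cast

/-- The operator whose injectivity on harmonic cocycles and on `ℓ²(H)` gives the bound. -/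
theorem exists_comparison_operator (hS : Subgroup.closure (S : Set G) = ⊤) [H.FiniteIndex]
    [Infinite H] {T : Finset H} (hT : Subgroup.closure (T : Set H) = ⊤)
    [(harmonicCocycles S).HasOrthogonalProjection] :
    ∃ A : EllTwo ((G × S) ⊕ H) →L[ℂ] EllTwo (H × T),
      Equivariant (fun h : H => Equiv.sumCongr (prodPerm S (Equiv.mulLeft (h : G)))
        (Equiv.mulLeft h)) (fun h => prodPerm T (Equiv.mulLeft h)) A ∧
      ∀ x, A x = 0 →
        (harmonicCocycles S).starProjection (pullback Sum.inl Sum.inl_injective x) = 0 ∧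
        pullback Sum.inr Sum.inr_injective x = 0 := by
  choose D hD hD' using exists_cocycle_evaluation hS
  set V := harmonicCocycles S
  let inl : EllTwo ((G × S) ⊕ H) →L[ℂ] EllTwo (G × S) := pullback Sum.inl Sum.inl_injective
  let inr : EllTwo ((G × S) ⊕ H) →L[ℂ] EllTwo H := pullback Sum.inr Sum.inr_injective
  let res : EllTwo G →L[ℂ] EllTwo H := pullback Subtype.val Subtype.val_injective
  -- The projection is composed in, rather than restricting the domain to V, so that the domain
  -- stays an ℓ² space with a free permutation action; the kernel gains Vᗮ.
  let M (t : T) : EllTwo ((G × S) ⊕ H) →L[ℂ] EllTwo H :=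
    res ∘L D t ∘L V.starProjection ∘L inl + (permute (Equiv.mulRight (t : H)) ∘L inr - inr)
  refine ⟨glue M, Equivariant.glue fun t => ?_, fun x hx => ?_⟩
  · have hP : Equivariant (fun h : H => prodPerm S (Equiv.mulLeft (h : G)))
        (fun h : H => prodPerm S (Equiv.mulLeft (h : G))) V.starProjection :=
      fun h f => starProjection_harmonicCocycles_permute (h : G) f
    have hinl : Equivariant (fun h : H => Equiv.sumCongr (prodPerm S (Equiv.mulLeft (h : G)))
        (Equiv.mulLeft h)) (fun h : H => prodPerm S (Equiv.mulLeft (h : G))) inl :=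
      fun _ _ => rfl
    have hinr : Equivariant (fun h : H => Equiv.sumCongr (prodPerm S (Equiv.mulLeft (h : G)))
        (Equiv.mulLeft h)) Equiv.mulLeft inr := fun _ _ => rfl
    have hres : Equivariant (fun h : H => Equiv.mulLeft (h : G)) Equiv.mulLeft res :=
      fun _ _ => rfl
    have hDt : Equivariant (fun h : H => prodPerm S (Equiv.mulLeft (h : G)))
        (fun h : H => Equiv.mulLeft (h : G)) (D t) := fun h f => hD t h f
    have hR : Equivariant (Equiv.mulLeft (G := H)) Equiv.mulLeft
        (permute (Equiv.mulRight (t : H))) := by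
      intro l f
      ext x
      simp [mul_assoc]
    exact (hres.comp (hDt.comp (hP.comp hinl))).add ((hR.comp hinr).sub hinr)
  · have hV : V.starProjection (inl x) ∈ V := Submodule.starProjection_apply_mem _ _
    obtain ⟨b, hb, hf⟩ := hV.1
    have key (t : H) (ht : t ∈ T) (h : H) : b t h = (-inr x) (h * t) - (-inr x) h := by
      have h1 : glue M x (h, ⟨t, ht⟩) = 0 := by rw [hx]; rfl
      rw [glue_apply] at h1
      change D t (V.starProjection (inl x)) h + (inr x (h * t) - inr x h) = 0 at h1
      rw [hD' _ b _ hb hf] at h1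
      change b t h = - inr x (h * t) - -inr x h
      linear_combination h1
    have h0 : V.starProjection (inl x) = 0 :=
      (Submodule.orthogonal_disjoint (coboundaries S)).le_bot
        ⟨hb.mem_coboundaries_of_restrict hf hT key, hV.2⟩
    refine ⟨h0, ?_⟩
    refine eq_zero_of_forall_eq (c := inr x 1) fun h =>
      Subgroup.apply_eq_of_forall_mul_eq hT (w := fun h : H => inr x h) (fun t ht h => ?_) h 1
    have h2 := key t ht h
    rw [← hD' _ b _ hb hf, h0, map_zero] at h2
    change 0 = - inr x (h * t) - -inr x h at h2
    change inr x (h * t) = inr x h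
    linear_combination h2

theorem index_mul_firstBetti_add_one_le (hS : Subgroup.closure (S : Set G) = ⊤) [H.FiniteIndex]
    [Infinite H] {T : Finset H} (hT : Subgroup.closure (T : Set H) = ⊤) :
    (H.index : ℝ) * firstBetti S + 1 ≤ T.card := by
  have : CompleteSpace (harmonicCocycles S) := 
    IsComplete.completeSpace_coe
      ((isClosed_cocycles hS).inter (Submodule.isClosed_orthogonal _)).isComplete
  obtain ⟨A, hA, hker⟩ := exists_comparison_operator hS hT
  obtain ⟨R, hR, -⟩ := H.exists_isComplement_right 1
  have : Fintype R := hR.finite_right.fintype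
  -- Orbit representatives for `H`: the transversal times `S`, and one point for the summand ℓ²(H),
  -- which is the source of the `+ 1`.
  let a : (R × S) ⊕ Unit → (G × S) ⊕ H := Sum.map (fun p => ((p.1 : G), p.2)) fun _ => 1
  let c (t : T) : H × T := (1, t)
  have hc : Bijective fun p : H × T => prodPerm T (Equiv.mulLeft p.1) (c p.2) := by
    convert Function.bijective_id with p
    simp [c]
  have ha : Bijective fun p : H × ((R × S) ⊕ Unit) =>
      (Equiv.sumCongr (prodPerm S (Equiv.mulLeft (p.1 : G))) (Equiv.mulLeft p.1))⁻¹ (a p.2) := by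
    have hfun : (fun p : H × ((R × S) ⊕ Unit) => (Equiv.sumCongr
        (prodPerm S (Equiv.mulLeft (p.1 : G))) (Equiv.mulLeft p.1))⁻¹ (a p.2)) = fun p =>
        p.2.elim (fun q => Sum.inl (((p.1⁻¹ : H) : G) * q.1, q.2)) fun _ => Sum.inr p.1⁻¹ := by
      funext ⟨h, q⟩
      rcases q with ⟨r, s⟩ | _
      · rfl
      · exact congrArg Sum.inr (mul_one h⁻¹)
    rw [hfun]
    constructor
    · rintro ⟨h, ⟨r, s⟩ | _⟩ ⟨h', ⟨r', s'⟩ | _⟩ heq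
      · simp only [Sum.elim_inl, Sum.inl.injEq, Prod.mk.injEq] at heq
        obtain ⟨h1, rfl⟩ := heq
        have h2 := hR.1 (a₁ := (h⁻¹, r)) (a₂ := (h'⁻¹, r')) h1
        simp only [Prod.mk.injEq, inv_inj] at h2
        rw [h2.1, h2.2]
      · simp at heq
      · simp at heq
      · simpa using heq
    · rintro (⟨x, s⟩ | h)
      · obtain ⟨⟨h, r⟩, rfl⟩ := hR.2 x
        exact ⟨(h⁻¹, Sum.inl (r, s)), by simp⟩
      · exact ⟨(h⁻¹, Sum.inr ()), by simp⟩
  have hmain := card_le_card_add ha hc hA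
  have hmem (q) : A (A.ker.starProjection (delta q)) = 0 :=
    LinearMap.mem_ker.mp (A.ker.starProjection_apply_mem (delta q))
  have hinr : A.ker.starProjection (delta (a (Sum.inr ()))) = 0 := by
    have h1 := norm_sq_starProjection_delta A.ker (a (Sum.inr ()))
    have h2 : A.ker.starProjection (delta (a (Sum.inr ()))) (a (Sum.inr ())) = 0 :=
      congrArg (fun f : EllTwo H => f 1) (hker _ (hmem (a (Sum.inr ())))).2
    rw [h2] at h1
    simpa using h1
  -- With δ the basis vector, y its projection to ker A and z the ℓ²(G × S) part of y, z lies in Vᗮ.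
  -- Hence ‖y‖² = ⟪P_{Vᗮ}δ, z⟫ ≤ ‖P_{Vᗮ}δ‖‖y‖, so ‖y‖² ≤ ‖P_{Vᗮ}δ‖² = 1 - ‖P_V δ‖².
  have hinl (p : R × S) : ‖A.ker.starProjection (delta (a (Sum.inl p)))‖ ^ 2 ≤
      1 - ‖(harmonicCocycles S).starProjection (delta ((p.1 : G), p.2))‖ ^ 2 := by
    obtain ⟨y, hy⟩ : ∃ y, y = A.ker.starProjection (delta (a (Sum.inl p))) := ⟨_, rfl⟩
    obtain ⟨z, hz⟩ : ∃ z, z = pullback Sum.inl Sum.inl_injective y := ⟨_, rfl⟩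
    have h1 := norm_sq_starProjection_delta A.ker (a (Sum.inl p))
    have h2 : (harmonicCocycles S).starProjection z = 0 := by
      rw [hz, hy]; exact (hker _ (hmem _)).1
    have h3 : (harmonicCocycles S)ᗮ.starProjection z = z := by
      rw [Submodule.starProjection_orthogonal_val, h2, sub_zero]
    have h4 : ‖z‖ ≤ ‖y‖ := by
      rw [hz]
      exact (le_of_opNorm_le _ (LinearMap.mkContinuous_norm_le _ zero_le_one _) y).trans
        (one_mul _).le
    have h5 : ((‖y‖ ^ 2 : ℝ) : ℂ) =
        ⟪(harmonicCocycles S)ᗮ.starProjection (delta ((p.1 : G), p.2)), z⟫ := by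
      rw [Submodule.inner_starProjection_left_eq_right, h3, inner_delta_left, hz, hy, h1]
      rfl
    have h6 : ‖y‖ ^ 2 ≤
        ‖(harmonicCocycles S)ᗮ.starProjection (delta ((p.1 : G), p.2))‖ * ‖y‖ := by
      have h := norm_inner_le_norm (𝕜 := ℂ)
        ((harmonicCocycles S)ᗮ.starProjection (delta ((p.1 : G), p.2))) z
      rw [← h5, Complex.norm_real, Real.norm_of_nonneg (by positivity)] at h
      exact h.trans (by gcongr)
    have h7 := Submodule.norm_sq_eq_add_norm_sq_starProjection (delta ((p.1 : G), p.2))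
      (harmonicCocycles S)
    rw [norm_delta] at h7
    rw [← hy]
    nlinarith [sq_nonneg
      (‖(harmonicCocycles S)ᗮ.starProjection (delta ((p.1 : G), p.2))‖ - ‖y‖)]
  have hcard : (Fintype.card R : ℝ) = H.index := by
    rw [← hR.card_right, Nat.card_eq_fintype_card]
  have hsum : ∑ p : R × S, ‖(harmonicCocycles S).starProjection (delta ((p.1 : G), p.2))‖ ^ 2 =
      H.index * firstBetti S := by
    rw [Fintype.sum_prod_type, ← hcard, ← nsmul_eq_mul, ← Finset.card_univ]
    exact Finset.sum_eq_card_nsmul fun r _ => (firstBetti_eq_sum hS (r : G)).symm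
  have hle := Finset.sum_le_sum fun p (_ : p ∈ Finset.univ) => hinl p
  rw [Finset.sum_sub_distrib, hsum] at hle
  rw [Fintype.sum_sum_type] at hmain
  simp [hinr] at hmain hle
  linarith

end Subgroups

end L2

end


theorem theorem2p2 (G : Type*) [Group G] [Group.FG G] [Infinite G]
    (S : Finset G) (hS : Subgroup.closure (S : Set G) = ⊤) :
    L2.firstBetti S ≤ rankGradient G := by
  have : Nonempty {H : Subgroup G // H.FiniteIndex} := ⟨⟨⊤, inferInstance⟩⟩
  refine le_ciInf fun H => ?_
  have : H.1.FiniteIndex := H.2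
  have : Infinite H.1 := by
    rw [← not_finite_iff_infinite]
    exact fun hfin => not_finite_iff_infinite.mpr ‹Infinite G›
      ((Subgroup.finite_iff_finite_and_finiteIndex H.1).mpr ⟨hfin, H.2⟩)
  obtain ⟨T, hcard, hT⟩ := Group.rank_spec H.1
  have hpos : (0 : ℝ) < H.1.index := by
    exact_mod_cast Nat.pos_of_ne_zero Subgroup.FiniteIndex.index_ne_zero
  have h := L2.index_mul_firstBetti_add_one_le hS hT
  rw [hcard] at h
  rw [le_div_iff₀ hpos]
  linarith
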